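/- Let $\Sigma$ be a smooth three-manifold (Hausdorff, second countable, without boundary). A \emph{Cauchy pair} on $\Sigma$ is a pair $(\mathfrak{e},\Theta)$ of a smooth global coframe $\mathfrak{e}=(e_u,e_l,e_n)$ (three smooth one-forms forming a basis of every cotangent space) and a smooth symmetric bilinear form $\Theta\in\Gamma(S^2T^*\Sigma)$. Let $$h_{\mathfrak{e}} = e_u\otimes e_u+e_l\otimes e_l+e_n\otimes e_n$$ be the associated Riemannian metric, $\nabla$ its Levi-Civita connection, and $\Theta(e_a):=\Theta(e_a^\sharp,\cdot)$, where $(e_u^\sharp,e_l^\sharp,e_n^\sharp)$ is the dual frame, which is $h_{\mathfrak{e}}$-orthonormal. The pair is \emph{parallel} if $$\mathrm{d}e_u=\Theta(e_u)\wedge e_u,\qquad \mathrm{d}e_l=\Theta(e_l)\wedge e_u,\qquad \mathrm{d}e_n=\Theta(e_n)\wedge e_u,\qquad(1)$$ $$[\Theta(e_u)]=0\in H^1(\Sigma,\mathbb{R}),\qquad(2)$$ where (2) says that $\Theta(e_u)$ is closed and its de Rham class vanishes. It is \emph{constrained Ricci-flat} if it is parallel and satisfies the Hamiltonian and the momentum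 constraint $$R_{h_{\mathfrak{e}}}=|\Theta|^2_{h_{\mathfrak{e}}}-\mathrm{Tr}_{h_{\mathfrak{e}}}(\Theta)^2\quad(3),\qquad\qquad \mathrm{d}\,\mathrm{Tr}_{h_{\mathfrak{e}}}(\Theta)=\mathrm{div}_{h_{\mathfrak{e}}}(\Theta)\quad(4),$$ where $R_{h_{\mathfrak{e}}}$ is the scalar curvature and $\mathrm{div}_{h_{\mathfrak{e}}}(\Theta)(Y)=\sum_{a\in\{u,l,n\}}(\nabla_{e_a^\sharp}\Theta)(e_a^\sharp,Y)$. The form $\Theta$ is \emph{Codazzi} if $(\nabla_X\Theta)(Y,Z)=(\nabla_Y\Theta)(X,Z)$ for all smooth vector fields $X,Y,Z$. Then a Cauchy pair $(\mathfrak{e},\Theta)$ on $\Sigma$ is a constrained Ricci-flat parallel Cauchy pair if and only if it satisfies (1), (2) and (3). In particular, every parallel Cauchy pair whose form $\Theta$ is Codazzi is constrained Ricci-flat. -/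

import Mathlib

open Bundle Manifold ContDiff VectorField

noncomputable section

namespace CauchyGeometry

section Riemannian

variable {E : Type*} [NormedAddCommGroup E] [NormedSpace ℝ E]
  {H : Type*} [TopologicalSpace H] {I : ModelWithCorners ℝ E H}
  {M : Type*} [TopologicalSpace M] [ChartedSpace H M] [IsManifold I ∞ M]

theorem mdifferentiableAt_inner (g : ContMDiffRiemannianMetric I ∞ E (TangentSpace I : M → Type _))
    {Y Z : ∀ x : M, TangentSpace I x} {x : M}
    (hY : MDiffAt (T% Y) x) (hZ : MDiffAt (T% Z) x) :
    MDiffAt (fun y ↦ g.inner y (Y y) (Z y)) x := by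
  have hg : MDifferentiableAt I (I.prod 𝓘(ℝ, E →L[ℝ] E →L[ℝ] ℝ))
      (fun y ↦ TotalSpace.mk' (E →L[ℝ] E →L[ℝ] ℝ) y (g.inner y)) x :=
    g.contMDiff.mdifferentiableAt (by simp)
  have h : MDifferentiableAt I (I.prod 𝓘(ℝ))
      (fun m ↦ TotalSpace.mk' ℝ (E := Bundle.Trivial M ℝ) m (g.inner m (Y m) (Z m))) x := by
    apply MDifferentiableAt.clm_bundle_apply₂ (F₁ := E) (F₂ := E)
    · exact hg
    · exact hY
    · exact hZ
  simp only [mdifferentiableAt_totalSpace] at h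
  exact h.2

variable [FiniteDimensional ℝ E]

/-- The Koszul expression `2 g(∇_X Y, Z)` of a Riemannian metric `g`. -/
def koszul (g : ContMDiffRiemannianMetric I ∞ E (TangentSpace I : M → Type _))
    (X Y Z : ∀ x : M, TangentSpace I x) (x : M) : ℝ :=
  mvfderiv I (fun y ↦ g.inner y (Y y) (Z y)) x (X x)
    + mvfderiv I (fun y ↦ g.inner y (X y) (Z y)) x (Y x)
    - mvfderiv I (fun y ↦ g.inner y (X y) (Y y)) x (Z x)
    + g.inner x (mlieBracket I X Y x) (Z x)
    - g.inner x (mlieBracket I X Z x) (Y x)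
    - g.inner x (mlieBracket I Y Z x) (X x)

variable (g : ContMDiffRiemannianMetric I ∞ E (TangentSpace I : M → Type _))
  {X X' Y Y' Z Z' : ∀ x : M, TangentSpace I x} {f : M → ℝ} {x : M}

theorem koszul_add_left (hX : MDiffAt (T% X) x) (hX' : MDiffAt (T% X') x)
    (hY : MDiffAt (T% Y) x) (hZ : MDiffAt (T% Z) x) :
    koszul g (X + X') Y Z x = koszul g X Y Z x + koszul g X' Y Z x := by
  have h1 := mvfderiv_add (mdifferentiableAt_inner g hX hZ) (mdifferentiableAt_inner g hX' hZ)
  have h2 := mvfderiv_add (mdifferentiableAt_inner g hX hY) (mdifferentiableAt_inner g hX' hY)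
  simp only [Pi.add_def] at h1 h2
  simp only [koszul, Pi.add_apply, map_add, _root_.add_apply, h1, h2,
    mlieBracket_add_left hX hX']
  ring

theorem koszul_smul_left (hf : MDiffAt f x) (hX : MDiffAt (T% X) x)
    (hY : MDiffAt (T% Y) x) (hZ : MDiffAt (T% Z) x) :
    koszul g (f • X) Y Z x = f x * koszul g X Y Z x := by
  have h1 := mvfderiv_mul hf (mdifferentiableAt_inner g hX hZ)
  have h2 := mvfderiv_mul hf (mdifferentiableAt_inner g hX hY)
  simp only [Pi.mul_def] at h1 h2
  simp [koszul, h1, h2, mlieBracket_smul_left hf hX]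
  ring

theorem koszul_add_right (hX : MDiffAt (T% X) x) (hY : MDiffAt (T% Y) x)
    (hZ : MDiffAt (T% Z) x) (hZ' : MDiffAt (T% Z') x) :
    koszul g X Y (Z + Z') x = koszul g X Y Z x + koszul g X Y Z' x := by
  have h1 := mvfderiv_add (mdifferentiableAt_inner g hX hZ) (mdifferentiableAt_inner g hX hZ')
  have h2 := mvfderiv_add (mdifferentiableAt_inner g hY hZ) (mdifferentiableAt_inner g hY hZ')
  simp only [Pi.add_def] at h1 h2
  simp only [koszul, Pi.add_apply, map_add, _root_.add_apply, h1, h2,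
    mlieBracket_add_right hZ hZ']
  ring

theorem koszul_smul_right (hf : MDiffAt f x) (hX : MDiffAt (T% X) x)
    (hY : MDiffAt (T% Y) x) (hZ : MDiffAt (T% Z) x) :
    koszul g X Y (f • Z) x = f x * koszul g X Y Z x := by
  have h1 := mvfderiv_mul hf (mdifferentiableAt_inner g hX hZ)
  have h2 := mvfderiv_mul hf (mdifferentiableAt_inner g hY hZ)
  simp only [Pi.mul_def] at h1 h2
  simp [koszul, h1, h2, mlieBracket_smul_right hf hZ]
  simp only [g.symm x (Z x)]
  ring

theorem koszul_add_mid (hX : MDiffAt (T% X) x) (hY : MDiffAt (T% Y) x)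
    (hY' : MDiffAt (T% Y') x) (hZ : MDiffAt (T% Z) x) :
    koszul g X (Y + Y') Z x = koszul g X Y Z x + koszul g X Y' Z x := by
  have h1 := mvfderiv_add (mdifferentiableAt_inner g hX hY) (mdifferentiableAt_inner g hX hY')
  have h2 := mvfderiv_add (mdifferentiableAt_inner g hY hZ) (mdifferentiableAt_inner g hY' hZ)
  simp only [Pi.add_def] at h1 h2
  simp only [koszul, Pi.add_apply, map_add, _root_.add_apply, h1, h2,
    mlieBracket_add_left hY hY', mlieBracket_add_right hY hY']
  ring

theorem koszul_smul_mid (hf : MDiffAt f x) (hX : MDiffAt (T% X) x)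
    (hY : MDiffAt (T% Y) x) (hZ : MDiffAt (T% Z) x) :
    koszul g X (f • Y) Z x
      = f x * koszul g X Y Z x + 2 * (mvfderiv I f x (X x) * g.inner x (Y x) (Z x)) := by
  have h1 := mvfderiv_mul hf (mdifferentiableAt_inner g hX hY)
  have h2 := mvfderiv_mul hf (mdifferentiableAt_inner g hY hZ)
  simp only [Pi.mul_def] at h1 h2
  simp [koszul, h1, h2, mlieBracket_smul_left hf hY, mlieBracket_smul_right hf hY]
  simp only [g.symm x (Y x) (X x)]
  ring

/-- The Koszul expression at `x` as a bilinear form in the values of `X` and `Z` at `x`. -/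
def koszulForm (Y : ∀ x : M, TangentSpace I x) (x : M) (hY : MDiffAt (T% Y) x) :
    TangentSpace I x →L[ℝ] TangentSpace I x →L[ℝ] ℝ :=
  TensorialAt.mkHom₂ (F := E) (F' := E) (I := I) (fun X Z ↦ koszul g X Y Z x) x
    (fun _ hZ ↦ ⟨fun hf hX ↦ koszul_smul_left g hf hX hY hZ,
      fun hX hX' ↦ koszul_add_left g hX hX' hY hZ⟩)
    (fun _ hX ↦ ⟨fun hf hZ ↦ koszul_smul_right g hf hX hY hZ,
      fun hZ hZ' ↦ koszul_add_right g hX hY hZ hZ'⟩)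

theorem koszulForm_apply (hX : MDiffAt (T% X) x) (hY : MDiffAt (T% Y) x)
    (hZ : MDiffAt (T% Z) x) : koszulForm g Y x hY (X x) (Z x) = koszul g X Y Z x :=
  TensorialAt.mkHom₂_apply _ _ hX hZ

/-- The musical isomorphism `v ↦ g(v, ·)` of a Riemannian metric. -/
def flat (x : M) : TangentSpace I x ≃L[ℝ] (TangentSpace I x →L[ℝ] ℝ) :=
  have : FiniteDimensional ℝ (TangentSpace I x) := inferInstanceAs (FiniteDimensional ℝ E)
  have : T2Space (TangentSpace I x) := inferInstanceAs (T2Space E)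
  (LinearEquiv.ofInjectiveOfFinrankEq (g.inner x).toLinearMap
    ((injective_iff_map_eq_zero _).2 fun v hv ↦ by
      by_contra h
      exact (g.pos x v h).ne' (by simpa using congr($hv v)))
    (by
      rw [← (LinearMap.toContinuousLinearMap (𝕜 := ℝ) (E := TangentSpace I x)
        (F' := ℝ)).finrank_eq]
      exact Subspace.dual_finrank_eq.symm)).toContinuousLinearEquiv

@[simp] theorem flat_apply (v w : TangentSpace I x) : flat g x v w = g.inner x v w := rfl

theorem ext_of_inner {v v' : TangentSpace I x}
    (h : ∀ w, 2 * g.inner x v w = 2 * g.inner x v' w) : v = v' :=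
  (flat g x).injective (by ext w; simpa using h w)

open scoped Classical in
/-- The covariant derivative of the Levi-Civita connection, as a bare function: `∇_X Y` at `x` is
`leviCivitaAux g Y x (X x)`. It is only meaningful where `Y` is differentiable. -/
def leviCivitaAux (Y : ∀ x : M, TangentSpace I x) (x : M) :
    TangentSpace I x →L[ℝ] TangentSpace I x :=
  if hY : MDiffAt (T% Y) x then
    (1 / 2 : ℝ) • ((flat g x).symm.toContinuousLinearMap ∘L koszulForm g Y x hY)
  else 0

theorem leviCivitaAux_koszul (hX : MDiffAt (T% X) x) (hY : MDiffAt (T% Y) x)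
    (hZ : MDiffAt (T% Z) x) :
    2 * g.inner x (leviCivitaAux g Y x (X x)) (Z x) = koszul g X Y Z x := by
  rw [← koszulForm_apply g hX hY hZ, leviCivitaAux, dif_pos hY, ← flat_apply]
  simp

/-- The Levi-Civita connection of a Riemannian metric, given by the Koszul formula. -/
def leviCivita : CovariantDerivative I E (TangentSpace I : M → Type _) where
  toFun := leviCivitaAux g
  isCovariantDerivativeOnUniv :=
    { add := by
        intro Y Y' x hY hY' _
        have hYY : MDiffAt (T% (Y + Y')) x := mdifferentiableAt_add_section hY hY'
        ext1 v
        refine ext_of_inner g fun w ↦ ?_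
        have hv := FiberBundle.mdifferentiableAt_extend I E v
        have hw := FiberBundle.mdifferentiableAt_extend I E w
        have h := leviCivitaAux_koszul g hv hYY hw
        rw [koszul_add_mid g hv hY hY' hw, ← leviCivitaAux_koszul g hv hY hw,
          ← leviCivitaAux_koszul g hv hY' hw] at h
        simp only [FiberBundle.extend_apply_self] at h
        simp [h, mul_add]
      leibniz := by
        intro Y f x hY hf _
        have hfY : MDiffAt (T% (f • Y)) x := hf.smul_section hY
        ext1 v
        refine ext_of_inner g fun w ↦ ?_
        have hv := FiberBundle.mdifferentiableAt_extend I E v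
        have hw := FiberBundle.mdifferentiableAt_extend I E w
        have h := leviCivitaAux_koszul g hv hfY hw
        rw [koszul_smul_mid g hf hv hY hw, ← leviCivitaAux_koszul g hv hY hw] at h
        simp only [FiberBundle.extend_apply_self] at h
        rw [h]
        simp
        ring }

/-- The Koszul formula. -/
theorem leviCivita_koszul (hX : MDiffAt (T% X) x) (hY : MDiffAt (T% Y) x)
    (hZ : MDiffAt (T% Z) x) :
    2 * g.inner x (leviCivita g Y x (X x)) (Z x) = koszul g X Y Z x :=
  leviCivitaAux_koszul g hX hY hZ

/-- The Levi-Civita connection is torsion-free. -/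
theorem leviCivita_torsion : (leviCivita g).torsion = 0 := by
  rw [CovariantDerivative.torsion_eq_zero_iff]
  intro X Y x hX hY
  refine ext_of_inner g fun w ↦ ?_
  have hw := FiberBundle.mdifferentiableAt_extend I E w
  have h1 := leviCivita_koszul g hX hY hw
  have h2 := leviCivita_koszul g hY hX hw
  simp only [koszul, FiberBundle.extend_apply_self, mlieBracket_swap_apply (V := Y) (W := X),
    map_neg, _root_.neg_apply] at h1 h2
  have h3 : (fun y ↦ g.inner y (Y y) (X y)) = fun y ↦ g.inner y (X y) (Y y) :=
    funext fun y ↦ g.symm y _ _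
  rw [h3] at h2
  simp only [map_sub, _root_.sub_apply]
  linarith

/-- The Levi-Civita connection is metric. -/
theorem leviCivita_metric (hX : MDiffAt (T% X) x) (hY : MDiffAt (T% Y) x)
    (hZ : MDiffAt (T% Z) x) :
    mvfderiv I (fun y ↦ g.inner y (Y y) (Z y)) x (X x) =
      g.inner x (leviCivita g Y x (X x)) (Z x) + g.inner x (Y x) (leviCivita g Z x (X x)) := by
  have h1 := leviCivita_koszul g hX hY hZ
  have h2 := leviCivita_koszul g hX hZ hY
  have h3 : (fun y ↦ g.inner y (Z y) (Y y)) = fun y ↦ g.inner y (Y y) (Z y) :=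
    funext fun y ↦ g.symm y _ _
  simp only [koszul, h3, mlieBracket_swap_apply (V := Z) (W := Y), map_neg,
    _root_.neg_apply] at h1 h2
  rw [g.symm x (Y x)]
  linarith

/-- The curvature `R(X,Y)Z = ∇_X ∇_Y Z - ∇_Y ∇_X Z - ∇_[X,Y] Z` of the Levi-Civita connection. -/
def curvature (X Y Z : ∀ x : M, TangentSpace I x) (x : M) : TangentSpace I x :=
  leviCivita g (fun y ↦ leviCivita g Z y (Y y)) x (X x)
    - leviCivita g (fun y ↦ leviCivita g Z y (X y)) x (Y x)
    - leviCivita g Z x (mlieBracket I X Y x)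

/-- The scalar curvature of `g`, as the trace `∑ₐ ∑ᵦ g(R(eₐ,eᵦ)eᵦ, eₐ)` over a smooth `g`-orthonormal
frame `e` (the value does not depend on the choice of this frame). It is positive on spheres. -/
def scalarCurvature {ι : Type*} [Fintype ι] (e : ι → ∀ x : M, TangentSpace I x) (x : M) : ℝ :=
  ∑ a, ∑ b, g.inner x (curvature g (e a) (e b) (e b) x) (e a x)

end Riemannian

/-- The model space of three-manifolds. -/
abbrev E3 : Type := EuclideanSpace ℝ (Fin 3)

theorem contMDiffAt_smulRight {M : Type*} [TopologicalSpace M] [ChartedSpace E3 M]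
    {G : Type*} [NormedAddCommGroup G] [NormedSpace ℝ G]
    {φ : M → E3 →L[ℝ] ℝ} {c : M → G} {x₀ : M}
    (hφ : ContMDiffAt (𝓡 3) 𝓘(ℝ, E3 →L[ℝ] ℝ) ∞ φ x₀) (hc : ContMDiffAt (𝓡 3) 𝓘(ℝ, G) ∞ c x₀) :
    ContMDiffAt (𝓡 3) 𝓘(ℝ, E3 →L[ℝ] G) ∞ (fun x ↦ (φ x).smulRight (c x)) x₀ :=
  (isBoundedBilinearMap_smulRight (𝕜 := ℝ) (E := E3) (F := G)).contDiff.contMDiff.contMDiffAt.comp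
    x₀ (hφ.prodMk_space hc)

section Tensors

variable (M : Type*) [TopologicalSpace M] [ChartedSpace E3 M] [IsManifold (𝓡 3) ∞ M]

/-- Smooth vector fields. -/
abbrev VectorField : Type _ := Cₛ^∞⟮𝓡 3; E3, (TangentSpace (𝓡 3) : M → Type _)⟯

/-- Smooth one-forms. -/
abbrev OneForm : Type _ :=
  Cₛ^∞⟮𝓡 3; E3 →L[ℝ] ℝ, (fun x : M ↦ TangentSpace (𝓡 3) x →L[ℝ] ℝ)⟯

/-- Smooth sections of `T*M ⊗ T*M`. -/
abbrev BilinForm : Type _ :=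
  Cₛ^∞⟮𝓡 3; E3 →L[ℝ] E3 →L[ℝ] ℝ,
    (fun x : M ↦ TangentSpace (𝓡 3) x →L[ℝ] TangentSpace (𝓡 3) x →L[ℝ] ℝ)⟯

/-- A smooth global coframe: three smooth one-forms `(e_u, e_l, e_n)`, indexed by `0, 1, 2`, that
form a basis of each cotangent space. -/
structure Coframe where
  form : Fin 3 → OneForm M
  linearIndependent : ∀ x, LinearIndependent ℝ fun a ↦ form a x

/-- A Cauchy pair: a coframe and a symmetric bilinear form `Θ`. -/
structure CauchyPair where
  coframe : Coframe M
  Θ : BilinForm M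
  symm : ∀ x v w, Θ x v w = Θ x w v

end Tensors

section
variable {M : Type*} [TopologicalSpace M] [ChartedSpace E3 M] [IsManifold (𝓡 3) ∞ M]

theorem OneForm.mdifferentiableAt_apply (α : OneForm M)
    {Y : ∀ x : M, TangentSpace (𝓡 3) x} {x : M}
    (hY : MDifferentiableAt (𝓡 3) ((𝓡 3).prod 𝓘(ℝ, E3)) (fun y ↦ TotalSpace.mk' E3 y (Y y)) x) :
    MDifferentiableAt (𝓡 3) 𝓘(ℝ) (fun y ↦ α y (Y y)) x := by
  have h : MDifferentiableAt (𝓡 3) ((𝓡 3).prod 𝓘(ℝ))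
      (fun m ↦ TotalSpace.mk' ℝ (E := Bundle.Trivial M ℝ) m (α m (Y m))) x := by
    apply MDifferentiableAt.clm_bundle_apply (F₁ := E3)
    · exact α.mdifferentiableAt
    · exact hY
  simp only [mdifferentiableAt_totalSpace] at h
  exact h.2

/-- A one-form read in the trivialization at `x₀` is smooth at `x₀`. -/
theorem OneForm.contMDiffAt_coord (α : OneForm M) (x₀ : M) :
    ContMDiffAt (𝓡 3) 𝓘(ℝ, E3 →L[ℝ] ℝ) ∞
      (fun x ↦ (α x).comp ((trivializationAt E3 (TangentSpace (𝓡 3)) x₀).symmL ℝ x)) x₀ := by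
  have h := ((contMDiffAt_hom_bundle _).1 (α.contMDiff x₀)).2
  simpa [ContinuousLinearMap.inCoordinates] using h

namespace Coframe
variable (e : Coframe M)

theorem eq_zero {x : M} {v : TangentSpace (𝓡 3) x} (h : ∀ a, e.form a x v = 0) : v = 0 := by
  have hF : FiniteDimensional ℝ (TangentSpace (𝓡 3) x) :=
    inferInstanceAs (FiniteDimensional ℝ E3)
  have hT : T2Space (TangentSpace (𝓡 3) x) := inferInstanceAs (T2Space E3)
  have hc : Fintype.card (Fin 3) = Module.finrank ℝ (TangentSpace (𝓡 3) x →L[ℝ] ℝ) := by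
    rw [← (LinearMap.toContinuousLinearMap (𝕜 := ℝ) (E := TangentSpace (𝓡 3) x)
      (F' := ℝ)).finrank_eq]
    refine Eq.trans ?_ Subspace.dual_finrank_eq.symm
    exact (Fintype.card_fin 3).trans (finrank_euclideanSpace_fin (𝕜 := ℝ) (n := 3)).symm
  have : FiniteDimensional ℝ (TangentSpace (𝓡 3) x →L[ℝ] ℝ) :=
    (LinearMap.toContinuousLinearMap (𝕜 := ℝ) (E := TangentSpace (𝓡 3) x)
      (F' := ℝ)).finiteDimensional
  have hs := (e.linearIndependent x).span_eq_top_of_card_eq_finrank' hc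
  have hall : ∀ φ : TangentSpace (𝓡 3) x →L[ℝ] ℝ, φ v = 0 := by
    intro φ
    have hφ : φ ∈ Submodule.span ℝ (Set.range fun a ↦ e.form a x) := hs ▸ Submodule.mem_top
    induction hφ using Submodule.span_induction with
    | mem y hy => obtain ⟨a, rfl⟩ := hy; exact h a
    | zero => rfl
    | add y z _ _ hy hz => simp [hy, hz]
    | smul c y _ hy => simp [hy]
  have h0 : (innerSL ℝ : E3 →L[ℝ] E3 →L[ℝ] ℝ) v v = 0 :=
    hall ((innerSL ℝ : E3 →L[ℝ] E3 →L[ℝ] ℝ) v)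
  exact (inner_self_eq_zero (𝕜 := ℝ) (E := E3)).1 h0

/-- The coframe at a point, as a linear isomorphism `v ↦ (e_u(v), e_l(v), e_n(v))`. -/
def equiv (x : M) : TangentSpace (𝓡 3) x ≃L[ℝ] (Fin 3 → ℝ) :=
  have : FiniteDimensional ℝ (TangentSpace (𝓡 3) x) := inferInstanceAs (FiniteDimensional ℝ E3)
  have : T2Space (TangentSpace (𝓡 3) x) := inferInstanceAs (T2Space E3)
  (LinearEquiv.ofInjectiveOfFinrankEq
    (ContinuousLinearMap.pi fun a ↦ e.form a x : TangentSpace (𝓡 3) x →L[ℝ] (Fin 3 → ℝ)).toLinearMap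
    ((injective_iff_map_eq_zero _).2 fun v hv ↦ e.eq_zero fun a ↦ congrFun hv a)
    ((finrank_euclideanSpace (𝕜 := ℝ) (ι := Fin 3)).trans (by simp))).toContinuousLinearEquiv

@[simp] theorem equiv_apply (x : M) (v : TangentSpace (𝓡 3) x) (a : Fin 3) :
    e.equiv x v a = e.form a x v := rfl

/-- The frame dual to a coframe, `e_b (frame a) = δ_ab`. -/
def dualFrame (a : Fin 3) (x : M) : TangentSpace (𝓡 3) x :=
  (e.equiv x).symm (Pi.single a 1)

theorem form_dualFrame (a b : Fin 3) (x : M) :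
    e.form b x (e.dualFrame a x) = if b = a then 1 else 0 := by
  rw [← equiv_apply, dualFrame, ContinuousLinearEquiv.apply_symm_apply, Pi.single_apply]

theorem contMDiff_dualFrame (a : Fin 3) :
    ContMDiff (𝓡 3) ((𝓡 3).prod 𝓘(ℝ, E3)) ∞ (fun x ↦ TotalSpace.mk' E3 x (e.dualFrame a x)) := by
  intro x₀
  set t := trivializationAt E3 (TangentSpace (𝓡 3) : M → Type _) x₀ with ht
  let A : M → E3 →L[ℝ] (Fin 3 → ℝ) := fun x ↦ ∑ b,
    ((e.form b x).comp (t.symmL ℝ x)).smulRight (Pi.single b 1 : Fin 3 → ℝ)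
  have hA : ContMDiffAt (𝓡 3) 𝓘(ℝ, E3 →L[ℝ] (Fin 3 → ℝ)) ∞ A x₀ := by
    refine ContMDiffAt.sum fun b _ ↦ ?_
    exact contMDiffAt_smulRight ((e.form b).contMDiffAt_coord x₀) contMDiffAt_const
  have hmem : x₀ ∈ t.baseSet := FiberBundle.mem_baseSet_trivializationAt E3 _ x₀
  have hAe : ∀ x (hx : x ∈ t.baseSet),
      A x = ((t.continuousLinearEquivAt ℝ x hx).symm.trans (e.equiv x) :
        E3 →L[ℝ] (Fin 3 → ℝ)) := by
    intro x hx
    ext v c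
    simp [A, Pi.single_apply, t.symmL_apply hx]
  rw [contMDiffAt_totalSpace]
  refine ⟨contMDiffAt_id, ?_⟩
  have hinv : ContMDiffAt (𝓡 3) 𝓘(ℝ, E3) ∞ (fun x ↦ (A x).inverse (Pi.single a 1)) x₀ := by
    refine ContMDiffAt.clm_apply ?_ contMDiffAt_const
    have h1 : ContDiffAt ℝ ∞ ContinuousLinearMap.inverse (A x₀) := by
      rw [hAe x₀ hmem]
      exact contDiffAt_map_inverse _
    exact h1.contMDiffAt.comp x₀ hA
  refine hinv.congr_of_eventuallyEq ?_
  filter_upwards [t.open_baseSet.mem_nhds hmem] with x hx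
  rw [hAe x hx, ContinuousLinearMap.inverse_equiv]
  rfl

theorem contMDiff_metric :
    ContMDiff (𝓡 3) ((𝓡 3).prod 𝓘(ℝ, E3 →L[ℝ] E3 →L[ℝ] ℝ)) ∞
      (fun x ↦ TotalSpace.mk' (E3 →L[ℝ] E3 →L[ℝ] ℝ) x
        (∑ a, (e.form a x).smulRight (e.form a x) :
          TangentSpace (𝓡 3) x →L[ℝ] TangentSpace (𝓡 3) x →L[ℝ] ℝ)) := by
  intro x₀
  rw [contMDiffAt_hom_bundle]
  refine ⟨contMDiffAt_id, ?_⟩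
  set t := trivializationAt E3 (TangentSpace (𝓡 3) : M → Type _) x₀ with ht
  have hmem : x₀ ∈ t.baseSet := FiberBundle.mem_baseSet_trivializationAt E3 _ x₀
  have hA : ContMDiffAt (𝓡 3) 𝓘(ℝ, E3 →L[ℝ] E3 →L[ℝ] ℝ) ∞ (fun x ↦
      ∑ b, ((e.form b x).comp (t.symmL ℝ x)).smulRight
        ((e.form b x).comp (t.symmL ℝ x))) x₀ := by
    refine ContMDiffAt.sum fun b _ ↦ ?_
    exact contMDiffAt_smulRight ((e.form b).contMDiffAt_coord x₀)
      ((e.form b).contMDiffAt_coord x₀)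
  refine hA.congr_of_eventuallyEq ?_
  filter_upwards [t.open_baseSet.mem_nhds hmem] with x hx
  ext v w
  rw [inCoordinates_apply_eq₂ hx hx (Set.mem_univ x)]
  simp [t.symmL_apply hx, ← ht]

/-- The Riemannian metric `e_u ⊗ e_u + e_l ⊗ e_l + e_n ⊗ e_n` of a coframe. -/
def metric : ContMDiffRiemannianMetric (𝓡 3) ∞ E3 (TangentSpace (𝓡 3) : M → Type _) where
  inner x := ∑ a, (e.form a x).smulRight (e.form a x)
  symm x v w := by
    simp [mul_comm]
  pos x v hv := by
    have h : ∃ a, e.form a x v ≠ 0 := by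
      by_contra! h
      exact hv (e.eq_zero h)
    obtain ⟨a, ha⟩ := h
    simp only [FunLike.coe_sum, Finset.sum_apply, ContinuousLinearMap.smulRight_apply,
      _root_.smul_apply, smul_eq_mul]
    exact Finset.sum_pos' (fun b _ ↦ mul_self_nonneg _)
      ⟨a, Finset.mem_univ a, mul_self_pos.2 ha⟩
  isVonNBounded x := by
    have hb : Bornology.IsVonNBounded ℝ (Metric.ball (0 : Fin 3 → ℝ) 1) :=
      NormedSpace.isVonNBounded_ball ℝ _ _
    refine (hb.image (e.equiv x).symm.toContinuousLinearMap).subset fun v hv ↦ ?_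
    refine ⟨e.equiv x v, ?_, (e.equiv x).symm_apply_apply v⟩
    rw [mem_ball_zero_iff, pi_norm_lt_iff one_pos]
    intro a
    have hv' : ∑ b, e.form b x v * e.form b x v < 1 := by simpa using hv
    have ha : e.form a x v * e.form a x v ≤ ∑ b, e.form b x v * e.form b x v :=
      Finset.single_le_sum (f := fun b ↦ e.form b x v * e.form b x v)
        (fun b _ ↦ mul_self_nonneg _) (Finset.mem_univ a)
    rw [equiv_apply, Real.norm_eq_abs, abs_lt]
    constructor <;> nlinarith
  contMDiff := e.contMDiff_metric

@[simp] theorem metric_apply (x : M) (v w : TangentSpace (𝓡 3) x) :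
    e.metric.inner x v w = ∑ a, e.form a x v * e.form a x w := by
  simp [metric]

/-- The dual frame is orthonormal for the metric of the coframe. -/
theorem metric_dualFrame (a b : Fin 3) (x : M) :
    e.metric.inner x (e.dualFrame a x) (e.dualFrame b x) = if a = b then 1 else 0 := by
  simp [form_dualFrame, eq_comm]

end Coframe

/-- The exterior derivative `dα(X,Y) = X(α(Y)) - Y(α(X)) - α([X,Y])`. -/
def extDeriv (α : OneForm M) (X Y : VectorField M) (x : M) : ℝ :=
  mvfderiv (𝓡 3) (fun y ↦ α y (Y y)) x (X x) - mvfderiv (𝓡 3) (fun y ↦ α y (X y)) x (Y x)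
    - α x (mlieBracket (𝓡 3) X Y x)

/-- The wedge product `α ∧ β = α ⊗ β - β ⊗ α`. -/
def wedge (α β : OneForm M) (X Y : VectorField M) (x : M) : ℝ :=
  α x (X x) * β x (Y x) - β x (X x) * α x (Y x)

variable (M) in
/-- The closed one-forms. -/
def closedForms : Submodule ℝ (OneForm M) where
  carrier := {α | ∀ X Y x, extDeriv α X Y x = 0}
  zero_mem' X Y x := by
    simp [extDeriv, mvfderiv_const]
  add_mem' {α β} hα hβ X Y x := by
    have h1 := mvfderiv_add (α.mdifferentiableAt_apply (X.mdifferentiableAt (x := x)))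
      (β.mdifferentiableAt_apply (X.mdifferentiableAt (x := x)))
    have h2 := mvfderiv_add (α.mdifferentiableAt_apply (Y.mdifferentiableAt (x := x)))
      (β.mdifferentiableAt_apply (Y.mdifferentiableAt (x := x)))
    have hα := hα X Y x
    have hβ := hβ X Y x
    simp only [Pi.add_def] at h1 h2
    simp only [extDeriv] at hα hβ
    simp only [extDeriv, ContMDiffSection.coe_add, Pi.add_apply, _root_.add_apply, h1, h2]
    linarith
  smul_mem' c α hα X Y x := by
    have h1 := mvfderiv_mul (f := fun _ ↦ c) mdifferentiableAt_const
      (α.mdifferentiableAt_apply (X.mdifferentiableAt (x := x)))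
    have h2 := mvfderiv_mul (f := fun _ ↦ c) mdifferentiableAt_const
      (α.mdifferentiableAt_apply (Y.mdifferentiableAt (x := x)))
    have hα := hα X Y x
    simp only [Pi.mul_def] at h1 h2
    simp only [extDeriv] at hα
    simp only [extDeriv, ContMDiffSection.coe_smul, Pi.smul_apply, _root_.smul_apply, smul_eq_mul,
      h1, h2, mvfderiv_const, _root_.add_apply, smul_zero, _root_.zero_apply]
    linear_combination c * hα

variable (M) in
/-- The exact one-forms `df`, with `f` a smooth function. -/
def exactForms : Submodule ℝ (OneForm M) where
  carrier := {α | ∃ f : C^∞⟮𝓡 3, M; ℝ⟯, ∀ x, α x = mvfderiv (𝓡 3) f x}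
  zero_mem' := ⟨0, fun x ↦ by simp⟩
  add_mem' := by
    rintro α β ⟨f, hf⟩ ⟨k, hk⟩
    refine ⟨f + k, fun x ↦ ?_⟩
    have h := mvfderiv_add (f.contMDiff.mdifferentiableAt (x := x) (by simp))
      (k.contMDiff.mdifferentiableAt (x := x) (by simp))
    simp only [ContMDiffMap.coe_add, ContMDiffSection.coe_add, Pi.add_apply, hf, hk, h]
  smul_mem' := by
    rintro c α ⟨f, hf⟩
    refine ⟨c • f, fun x ↦ ?_⟩
    have h := mvfderiv_smul (a := fun _ ↦ c) mdifferentiableAt_const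
      (f.contMDiff.mdifferentiableAt (x := x) (by simp))
    simp only [mvfderiv_const, ContinuousLinearMap.zero_smulRight, add_zero] at h
    simp only [ContMDiffSection.coe_smul, Pi.smul_apply, hf]
    exact h.symm

variable (M) in
/-- The first de Rham cohomology group `H¹(M, ℝ)`: closed one-forms modulo exact ones. -/
abbrev H1 : Type _ := closedForms M ⧸ (exactForms M).submoduleOf (closedForms M)

/-- `[α] = 0 ∈ H¹(M, ℝ)`: the one-form `α` is closed and its cohomology class vanishes. -/
def VanishingClass (α : OneForm M) : Prop :=
  ∃ h : α ∈ closedForms M, (Submodule.Quotient.mk ⟨α, h⟩ : H1 M) = 0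

namespace CauchyPair
variable (p : CauchyPair M)

/-- The one-form `Θ(e_a)`, i.e. `Θ(e_a♯, ·)`; for the metric of the coframe, the dual `e_a♯` is
the vector field `e_a` of the dual frame. -/
def shape (a : Fin 3) : OneForm M where
  toFun x := p.Θ x (p.coframe.dualFrame a x)
  contMDiff_toFun := by
    apply ContMDiff.clm_bundle_apply (F₁ := E3)
    · exact p.Θ.contMDiff
    · exact p.coframe.contMDiff_dualFrame a

/-- The trace of `Θ`. -/
def trace (x : M) : ℝ := ∑ a, p.Θ x (p.coframe.dualFrame a x) (p.coframe.dualFrame a x)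

/-- The squared norm `|Θ|²`. -/
def normSq (x : M) : ℝ :=
  ∑ a, ∑ b, p.Θ x (p.coframe.dualFrame a x) (p.coframe.dualFrame b x) ^ 2

/-- The covariant derivative `(∇_X Θ)(Y, Z)` for the Levi-Civita connection of the coframe. -/
def covDeriv (X Y Z : ∀ x : M, TangentSpace (𝓡 3) x) (x : M) : ℝ :=
  mvfderiv (𝓡 3) (fun y ↦ p.Θ y (Y y) (Z y)) x (X x)
    - p.Θ x (leviCivita p.coframe.metric Y x (X x)) (Z x)
    - p.Θ x (Y x) (leviCivita p.coframe.metric Z x (X x))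

/-- The divergence `div(Θ)(Y) = ∑ₐ (∇_{eₐ} Θ)(eₐ, Y)`. -/
def div (Y : ∀ x : M, TangentSpace (𝓡 3) x) (x : M) : ℝ :=
  ∑ a, p.covDeriv (p.coframe.dualFrame a) (p.coframe.dualFrame a) Y x

/-- The exterior system `de_a = Θ(e_a) ∧ e_u` for the form `e_a`. -/
def ExteriorEq (a : Fin 3) : Prop :=
  ∀ X Y x, extDeriv (p.coframe.form a) X Y x = wedge (p.shape a) (p.coframe.form 0) X Y x

/-- Parallel Cauchy pairs. -/
def IsParallel : Prop := (∀ a, p.ExteriorEq a) ∧ VanishingClass (p.shape 0)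

/-- The Hamiltonian constraint `R = |Θ|² - Tr(Θ)²`. -/
def Hamiltonian : Prop :=
  ∀ x, scalarCurvature p.coframe.metric p.coframe.dualFrame x = p.normSq x - p.trace x ^ 2

/-- The momentum constraint `d Tr(Θ) = div(Θ)`. -/
def Momentum : Prop :=
  ∀ (Y : VectorField M) (x : M), mvfderiv (𝓡 3) p.trace x (Y x) = p.div Y x

/-- Constrained Ricci-flat parallel Cauchy pairs. -/
def IsConstrainedRicciFlat : Prop := p.IsParallel ∧ p.Hamiltonian ∧ p.Momentum

/-- `Θ` is a Codazzi tensor: `(∇_X Θ)(Y, Z) = (∇_Y Θ)(X, Z)`. -/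
def IsCodazzi : Prop :=
  ∀ (X Y Z : VectorField M) (x : M), p.covDeriv X Y Z x = p.covDeriv Y X Z x

end CauchyPair
end
end CauchyGeometry

end

/-!
Let `C(X, Y, Z) = (∇_X Θ)(Y, Z) - (∇_Y Θ)(X, Z)`. The exterior system determines the connection:
`∇_v e_b♯ = Θ(e_b)(v) e_u♯ - δ_{bu} Θ(v)♯`, where `Θ(v)♯` is the vector metrically dual to
`Θ(v, ·)`. Substituting this into `dΘ(e_b)` and into the curvature gives
`dΘ(e_b) = C(·, ·, e_b♯) + Θ(e_b) ∧ Θ(e_u)` and the Gauss equation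
`e_c(R e_b♯) = Θ(e_b) ∧ Θ(e_c) + δ_{cu} C(·, ·, e_b♯) - δ_{bu} C(·, ·, e_c♯)`.

Tracing the Gauss equation, `R_h = |Θ|² - Tr(Θ)² - 2 (div Θ - d Tr Θ)(e_u♯)`: the Hamiltonian
constraint is the `e_u` component of the momentum constraint. The other two components hold
automatically. Indeed they are traces of `C`, in which the terms `C(e_u♯, e_c♯, e_u♯)` vanish
because `Θ(e_u)` is closed, and the terms `C(e_b♯, e_c♯, e_b♯)` with `b, c ≠ u` vanish by the first
Bianchi identity for `R(e_b♯, e_c♯) e_u♯`.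
-/

noncomputable section

namespace CauchyGeometry

section LieBracket

variable {E : Type*} [NormedAddCommGroup E] [NormedSpace ℝ E] [CompleteSpace E]
  {H : Type*} [TopologicalSpace H] {I : ModelWithCorners ℝ E H}
  {M : Type*} [TopologicalSpace M] [ChartedSpace H M] [IsManifold I 3 M]
  {X Y Z : ∀ x : M, TangentSpace I x} {x : M}

theorem mdifferentiableAt_mlieBracket (hX : CMDiffAt 2 (T% X) x) (hY : CMDiffAt 2 (T% Y) x) :
    MDiffAt (T% (mlieBracket I X Y)) x := by
  have : IsManifold I (2 + 1) M := inferInstanceAs (IsManifold I 3 M)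
  have : IsManifold I (minSmoothness ℝ 2) M := .of_le (n := 3) (by norm_num)
  refine (ContMDiffAt.mlieBracket_vectorField (m := 1) (n := 2) hX hY ?_).mdifferentiableAt
    one_ne_zero
  simp [one_add_one_eq_two]

theorem mlieBracket_jacobi (hX : CMDiffAt 2 (T% X) x) (hY : CMDiffAt 2 (T% Y) x)
    (hZ : CMDiffAt 2 (T% Z) x) :
    mlieBracket I X (mlieBracket I Y Z) x + mlieBracket I Y (mlieBracket I Z X) x
      + mlieBracket I Z (mlieBracket I X Y) x = 0 := by
  have : IsManifold I (minSmoothness ℝ 3) M := by simpa using ‹IsManifold I 3 M›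
  have : IsManifold I (minSmoothness ℝ 2) M := .of_le (n := 3) (by norm_num)
  have swap : mlieBracket I Y (mlieBracket I Z X) x = -mlieBracket I Y (mlieBracket I X Z) x := by
    rw [mlieBracket_swap (V := Z) (W := X), ← neg_one_smul ℝ (mlieBracket I X Z),
      mlieBracket_const_smul_right (mdifferentiableAt_mlieBracket hX hZ), neg_one_smul]
  rw [leibniz_identity_mlieBracket_apply (by simpa using hX) (by simpa using hY)
    (by simpa using hZ), mlieBracket_swap_apply (V := mlieBracket I X Y), swap]
  abel

end LieBracket

section LeviCivita

variable {E : Type*} [NormedAddCommGroup E] [NormedSpace ℝ E] [FiniteDimensional ℝ E]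
  {H : Type*} [TopologicalSpace H] {I : ModelWithCorners ℝ E H}
  {M : Type*} [TopologicalSpace M] [ChartedSpace H M] [IsManifold I ∞ M]
  (g : ContMDiffRiemannianMetric I ∞ E (TangentSpace I : M → Type _))
  {X Y Z W : ∀ x : M, TangentSpace I x} {x : M}

theorem mvfderiv_inner (hY : MDiffAt (T% Y) x) (hZ : MDiffAt (T% Z) x) (v : TangentSpace I x) :
    mvfderiv I (fun y ↦ g.inner y (Y y) (Z y)) x v =
      g.inner x (leviCivita g Y x v) (Z x) + g.inner x (Y x) (leviCivita g Z x v) := by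
  simpa only [FiberBundle.extend_apply_self] using
    leviCivita_metric g (FiberBundle.mdifferentiableAt_extend I E v) hY hZ

theorem leviCivita_sub_leviCivita (hX : MDiffAt (T% X) x) (hY : MDiffAt (T% Y) x) :
    leviCivita g Y x (X x) - leviCivita g X x (Y x) = mlieBracket I X Y x :=
  (leviCivita g).torsion_eq_zero_iff.1 (leviCivita_torsion g) hX hY

theorem inner_curvature
    (hYZ : MDiffAt (T% fun y ↦ leviCivita g Z y (Y y)) x)
    (hXZ : MDiffAt (T% fun y ↦ leviCivita g Z y (X y)) x) (hW : MDiffAt (T% W) x) :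
    g.inner x (curvature g X Y Z x) (W x) =
      mvfderiv I (fun y ↦ g.inner y (leviCivita g Z y (Y y)) (W y)) x (X x)
        - mvfderiv I (fun y ↦ g.inner y (leviCivita g Z y (X y)) (W y)) x (Y x)
        - g.inner x (leviCivita g Z x (mlieBracket I X Y x)) (W x)
        - g.inner x (leviCivita g Z x (Y x)) (leviCivita g W x (X x))
        + g.inner x (leviCivita g Z x (X x)) (leviCivita g W x (Y x)) := by
  rw [mvfderiv_inner g hYZ hW, mvfderiv_inner g hXZ hW]
  simp only [curvature, map_sub, _root_.sub_apply]
  ring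

theorem leviCivita_leviCivita_sub_mlieBracket (hX : MDiffAt (T% X) x)
    (hY : MDiff (T% Y)) (hZ : MDiff (T% Z)) (hYZ : MDiffAt (T% (mlieBracket I Y Z)) x)
    (hZY : MDiffAt (T% fun y ↦ leviCivita g Y y (Z y)) x) :
    leviCivita g (fun y ↦ leviCivita g Z y (Y y)) x (X x)
        - leviCivita g X x (mlieBracket I Y Z x) =
      leviCivita g (fun y ↦ leviCivita g Y y (Z y)) x (X x)
        + mlieBracket I X (mlieBracket I Y Z) x := by
  have torsion_free : (fun y ↦ leviCivita g Z y (Y y))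
      = (fun y ↦ leviCivita g Y y (Z y)) + mlieBracket I Y Z :=
    funext fun y ↦ sub_eq_iff_eq_add'.1 (leviCivita_sub_leviCivita g (hY y) (hZ y))
  rw [torsion_free, (leviCivita g).isCovariantDerivativeOnUniv.add hZY hYZ, _root_.add_apply,
    ← leviCivita_sub_leviCivita g hX hYZ]
  abel

theorem curvature_bianchi (hX : CMDiff 2 (T% X)) (hY : CMDiff 2 (T% Y)) (hZ : CMDiff 2 (T% Z))
    (hYX : MDiffAt (T% fun y ↦ leviCivita g X y (Y y)) x)
    (hZY : MDiffAt (T% fun y ↦ leviCivita g Y y (Z y)) x)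
    (hXZ : MDiffAt (T% fun y ↦ leviCivita g Z y (X y)) x) :
    curvature g X Y Z x + curvature g Y Z X x + curvature g Z X Y x = 0 := by
  have : CompleteSpace E := FiniteDimensional.complete ℝ E
  have mdiff {V : ∀ x : M, TangentSpace I x} (hV : CMDiff 2 (T% V)) : MDiff (T% V) :=
    hV.mdifferentiable two_ne_zero
  have hXYZ := leviCivita_leviCivita_sub_mlieBracket g (mdiff hX x) (mdiff hY) (mdiff hZ)
    (mdifferentiableAt_mlieBracket (hY x) (hZ x)) hZY
  have hYZX := leviCivita_leviCivita_sub_mlieBracket g (mdiff hY x) (mdiff hZ) (mdiff hX)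
    (mdifferentiableAt_mlieBracket (hZ x) (hX x)) hXZ
  have hZXY := leviCivita_leviCivita_sub_mlieBracket g (mdiff hZ x) (mdiff hX) (mdiff hY)
    (mdifferentiableAt_mlieBracket (hX x) (hY x)) hYX
  have jacobi := mlieBracket_jacobi (hX x) (hY x) (hZ x)
  simp only [curvature]
  linear_combination (norm := module) hXYZ + hYZX + hZXY + jacobi

end LeviCivita

theorem mvfderiv_fun_sum {𝕜 : Type*} [NontriviallyNormedField 𝕜]
    {E : Type*} [NormedAddCommGroup E] [NormedSpace 𝕜 E] {H : Type*} [TopologicalSpace H]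
    {I : ModelWithCorners 𝕜 E H} {M : Type*} [TopologicalSpace M] [ChartedSpace H M]
    {F : Type*} [NormedAddCommGroup F] [NormedSpace 𝕜 F]
    {ι : Type*} {s : Finset ι} {f : ι → M → F} {x : M} (hf : ∀ i ∈ s, MDiffAt (f i) x) :
    mvfderiv I (fun y ↦ ∑ i ∈ s, f i y) x = ∑ i ∈ s, mvfderiv I (f i) x := by
  classical
  suffices MDiffAt (fun y ↦ ∑ i ∈ s, f i y) x ∧
      mvfderiv I (fun y ↦ ∑ i ∈ s, f i y) x = ∑ i ∈ s, mvfderiv I (f i) x from this.2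
  induction s using Finset.induction_on with
  | empty => exact ⟨mdifferentiableAt_const, mvfderiv_const 0⟩
  | insert i s hi ih =>
    obtain ⟨hsum, ih⟩ := ih fun j hj ↦ hf j (Finset.mem_insert_of_mem hj)
    have hi' := hf i (s.mem_insert_self i)
    simp only [Finset.sum_insert hi]
    exact ⟨hi'.add hsum, by rw [mvfderiv_fun_add hi' hsum, ih]⟩

section Frame

/-- The Kronecker symbol on the indices of a coframe, as the identity matrix. -/
abbrev δ : Matrix (Fin 3) (Fin 3) ℝ := 1

variable {M : Type*} [TopologicalSpace M] [ChartedSpace E3 M] [IsManifold (𝓡 3) ∞ M]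

/-- Differentiability at `x` of a vector field on a three-manifold, as a map into the tangent
bundle. -/
abbrev MDiffField (Y : ∀ x : M, TangentSpace (𝓡 3) x) (x : M) : Prop :=
  MDifferentiableAt (𝓡 3) ((𝓡 3).prod 𝓘(ℝ, E3)) (fun y ↦ TotalSpace.mk' E3 y (Y y)) x

namespace Coframe

variable (e : Coframe M) {x : M}

theorem ext_form {v w : TangentSpace (𝓡 3) x} (h : ∀ a, e.form a x v = e.form a x w) : v = w :=
  sub_eq_zero.1 (e.eq_zero fun a ↦ by rw [map_sub, h a, sub_self])

theorem sum_form_smul_dualFrame (v : TangentSpace (𝓡 3) x) :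
    ∑ a, e.form a x v • e.dualFrame a x = v :=
  e.ext_form fun b ↦ by simp [form_dualFrame]

theorem metric_dualFrame_right (v : TangentSpace (𝓡 3) x) (a : Fin 3) :
    e.metric.inner x v (e.dualFrame a x) = e.form a x v := by
  simp [form_dualFrame]

/-- The vector fields `e_a♯` of the dual frame as smooth sections. -/
def dualField (a : Fin 3) : VectorField M := ⟨e.dualFrame a, e.contMDiff_dualFrame a⟩

@[simp] theorem coe_dualField (a : Fin 3) : ⇑(e.dualField a) = e.dualFrame a := rfl

theorem mdifferentiableAt_dualFrame (a : Fin 3) (x : M) : MDiffField (e.dualFrame a) x :=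
  (e.dualField a).mdifferentiableAt

theorem mdifferentiableAt_of_form {W : ∀ x : M, TangentSpace (𝓡 3) x}
    (hW : ∀ a, MDifferentiableAt (𝓡 3) 𝓘(ℝ) (fun y ↦ e.form a y (W y)) x) : MDiffField W x := by
  have expansion : W = fun y ↦ ∑ a, e.form a y (W y) • e.dualFrame a y :=
    funext fun y ↦ (e.sum_form_smul_dualFrame (W y)).symm
  rw [expansion]
  exact MDifferentiableAt.sum_section fun a _ ↦
    (hW a).smul_section (e.mdifferentiableAt_dualFrame a x)

theorem mvfderiv_form_dualFrame (a b : Fin 3) (x : M) :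
    mvfderiv (𝓡 3) (fun y ↦ e.form a y (e.dualFrame b y)) x = 0 := by
  simp only [form_dualFrame]
  exact mvfderiv_const _

theorem extDeriv_form_dualField (a b c : Fin 3) (x : M) :
    extDeriv (e.form a) (e.dualField b) (e.dualField c) x
      = -e.form a x (mlieBracket (𝓡 3) (e.dualFrame b) (e.dualFrame c) x) := by
  simp [extDeriv, mvfderiv_form_dualFrame]

theorem two_mul_form_leviCivita_dualFrame (a b c : Fin 3) (x : M) :
    2 * e.form c x (leviCivita e.metric (e.dualFrame b) x (e.dualFrame a x)) =
      extDeriv (e.form b) (e.dualField a) (e.dualField c) x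
        + extDeriv (e.form a) (e.dualField b) (e.dualField c) x
        - extDeriv (e.form c) (e.dualField a) (e.dualField b) x := by
  have formula := leviCivita_koszul e.metric (e.mdifferentiableAt_dualFrame a x)
    (e.mdifferentiableAt_dualFrame b x) (e.mdifferentiableAt_dualFrame c x)
  simp only [koszul, metric_dualFrame_right, mvfderiv_form_dualFrame, _root_.zero_apply]
    at formula
  simp only [formula, extDeriv_form_dualField]
  ring

theorem form_leviCivita_dualFrame_skew (a b : Fin 3) (v : TangentSpace (𝓡 3) x) :
    e.form b x (leviCivita e.metric (e.dualFrame a) x v)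
      = -e.form a x (leviCivita e.metric (e.dualFrame b) x v) := by
  have h := mvfderiv_inner e.metric (e.mdifferentiableAt_dualFrame a x)
    (e.mdifferentiableAt_dualFrame b x) v
  rw [e.metric.symm x (e.dualFrame a x)] at h
  simp only [metric_dualFrame_right, mvfderiv_form_dualFrame, _root_.zero_apply] at h
  linarith

end Coframe

theorem BilinForm.mdifferentiableAt_apply (B : BilinForm M)
    {Y Z : ∀ x : M, TangentSpace (𝓡 3) x} {x : M} (hY : MDiffField Y x) (hZ : MDiffField Z x) :
    MDifferentiableAt (𝓡 3) 𝓘(ℝ) (fun y ↦ B y (Y y) (Z y)) x := by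
  have h : MDifferentiableAt (𝓡 3) ((𝓡 3).prod 𝓘(ℝ))
      (fun m ↦ TotalSpace.mk' ℝ (E := Bundle.Trivial M ℝ) m (B m (Y m) (Z m))) x := by
    apply MDifferentiableAt.clm_bundle_apply₂ (F₁ := E3) (F₂ := E3)
    · exact B.mdifferentiableAt
    · exact hY
    · exact hZ
  exact ((mdifferentiableAt_totalSpace _ _).1 h).2

namespace CauchyPair

section General

variable (p : CauchyPair M) {X Y Z : ∀ x : M, TangentSpace (𝓡 3) x} {x : M}

theorem shape_apply (a : Fin 3) (x : M) (v : TangentSpace (𝓡 3) x) :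
    p.shape a x v = p.Θ x (p.coframe.dualFrame a x) v := rfl

theorem apply_eq_sum (v w : TangentSpace (𝓡 3) x) :
    p.Θ x v w = ∑ a, p.coframe.form a x v * p.shape a x w := by
  conv_lhs => rw [← p.coframe.sum_form_smul_dualFrame v]
  simp [shape_apply]

theorem covDeriv_comm (X Y Z : ∀ x : M, TangentSpace (𝓡 3) x) (x : M) :
    p.covDeriv X Y Z x = p.covDeriv X Z Y x := by
  simp only [covDeriv, fun y ↦ p.symm y (Z y) (Y y), p.symm x _ (Z x), p.symm x (Y x)]
  ring

theorem sum_apply_leviCivita_dualFrame (v : TangentSpace (𝓡 3) x) :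
    ∑ a, p.Θ x (leviCivita p.coframe.metric (p.coframe.dualFrame a) x v) (p.coframe.dualFrame a x)
      = 0 := by
  -- Exchanging the two summation indices pairs skew connection coefficients with the symmetric `Θ`.
  simp only [p.apply_eq_sum (leviCivita _ _ _ _), shape_apply]
  refine self_eq_neg.1 ?_
  conv_lhs => rw [Finset.sum_comm]
  simp only [← Finset.sum_neg_distrib]
  refine Finset.sum_congr rfl fun a _ ↦ Finset.sum_congr rfl fun b _ ↦ ?_
  rw [p.coframe.form_leviCivita_dualFrame_skew, p.symm, neg_mul]

theorem mvfderiv_trace (Y : ∀ x : M, TangentSpace (𝓡 3) x) (x : M) :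
    mvfderiv (𝓡 3) p.trace x (Y x)
      = ∑ a, p.covDeriv Y (p.coframe.dualFrame a) (p.coframe.dualFrame a) x := by
  set E := p.coframe.dualFrame
  have diff (a : Fin 3) : MDifferentiableAt (𝓡 3) 𝓘(ℝ) (fun y ↦ p.Θ y (E a y) (E a y)) x :=
    p.Θ.mdifferentiableAt_apply (p.coframe.mdifferentiableAt_dualFrame a x)
      (p.coframe.mdifferentiableAt_dualFrame a x)
  have derivative : mvfderiv (𝓡 3) p.trace x
      = ∑ a, mvfderiv (𝓡 3) (fun y ↦ p.Θ y (E a y) (E a y)) x :=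
    mvfderiv_fun_sum fun a _ ↦ diff a
  simp only [derivative, covDeriv, FunLike.coe_sum, Finset.sum_apply, Finset.sum_sub_distrib,
    p.sum_apply_leviCivita_dualFrame, p.symm x (E _ x) (leviCivita _ _ _ _), sub_zero, E]

/-- The failure `(∇_X Θ)(Y, Z) - (∇_Y Θ)(X, Z)` of the Codazzi equation. -/
def codazziDefect (X Y Z : ∀ x : M, TangentSpace (𝓡 3) x) (x : M) : ℝ :=
  p.covDeriv X Y Z x - p.covDeriv Y X Z x

/-- The failure `div Θ (Y) - d Tr Θ (Y)` of the momentum constraint. -/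
def momentumDefect (Y : ∀ x : M, TangentSpace (𝓡 3) x) (x : M) : ℝ :=
  p.div Y x - mvfderiv (𝓡 3) p.trace x (Y x)

theorem codazziDefect_swap (X Y Z : ∀ x : M, TangentSpace (𝓡 3) x) (x : M) :
    p.codazziDefect X Y Z x = -p.codazziDefect Y X Z x :=
  (neg_sub _ _).symm

theorem momentumDefect_eq_sum_codazziDefect (Y : ∀ x : M, TangentSpace (𝓡 3) x) (x : M) :
    p.momentumDefect Y x
      = ∑ a, p.codazziDefect (p.coframe.dualFrame a) Y (p.coframe.dualFrame a) x := by
  simp only [momentumDefect, codazziDefect, div, mvfderiv_trace, Finset.sum_sub_distrib,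
    fun a ↦ p.covDeriv_comm (p.coframe.dualFrame a) Y]

variable {p} in
theorem IsCodazzi.codazziDefect_eq_zero (h : p.IsCodazzi) (X Y Z : VectorField M) (x : M) :
    p.codazziDefect X Y Z x = 0 :=
  sub_eq_zero.2 (h X Y Z x)

variable {p} in
theorem IsCodazzi.momentum (h : p.IsCodazzi) : p.Momentum := fun Y x ↦ by
  refine (sub_eq_zero.1 ?_).symm
  exact (p.momentumDefect_eq_sum_codazziDefect Y x).trans <| Finset.sum_eq_zero fun a _ ↦
    h.codazziDefect_eq_zero (p.coframe.dualField a) Y (p.coframe.dualField a) x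

theorem tensorialAt_covDeriv (X : ∀ x : M, TangentSpace (𝓡 3) x) (hY : MDiffField Y x) :
    TensorialAt (𝓡 3) E3 (fun Z : ∀ x : M, TangentSpace (𝓡 3) x ↦ p.covDeriv X Y Z x) x where
  smul {f Z} hf hZ := by
    have derivative := mvfderiv_fun_mul hf (p.Θ.mdifferentiableAt_apply hY hZ)
    have leibniz := (leviCivita p.coframe.metric).isCovariantDerivativeOnUniv.leibniz hZ hf
    simp only [covDeriv, Pi.smul_apply', map_smul, smul_eq_mul, derivative, _root_.add_apply,
      _root_.smul_apply, leibniz, ContinuousLinearMap.smulRight_apply, map_add]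
    ring
  add {Z Z'} hZ hZ' := by
    have derivative := mvfderiv_fun_add (p.Θ.mdifferentiableAt_apply hY hZ)
      (p.Θ.mdifferentiableAt_apply hY hZ')
    have additive := (leviCivita p.coframe.metric).isCovariantDerivativeOnUniv.add hZ hZ'
    simp only [covDeriv, Pi.add_apply, map_add, _root_.add_apply, derivative, additive]
    ring

theorem tensorialAt_div (x : M) :
    TensorialAt (𝓡 3) E3 (fun Y : ∀ x : M, TangentSpace (𝓡 3) x ↦ p.div Y x) x :=
  have tensorial (a : Fin 3) := p.tensorialAt_covDeriv (p.coframe.dualFrame a)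
    (p.coframe.mdifferentiableAt_dualFrame a x)
  { smul := fun hf hY ↦ by simp only [div, (tensorial _).smul hf hY, Finset.smul_sum]
    add := fun hY hY' ↦ by simp only [div, (tensorial _).add hY hY', Finset.sum_add_distrib] }

theorem momentum_iff :
    p.Momentum ↔ ∀ c x, p.momentumDefect (p.coframe.dualFrame c) x = 0 := by
  refine ⟨fun h c x ↦ sub_eq_zero.2 (h (p.coframe.dualField c) x).symm, fun h Y x ↦ ?_⟩
  have hY : MDiffField Y x := Y.mdifferentiableAt
  have hE (c : Fin 3) := TensorialAt.mkHom_apply (p.tensorialAt_div x)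
    (p.coframe.mdifferentiableAt_dualFrame c x)
  rw [← TensorialAt.mkHom_apply (p.tensorialAt_div x) hY,
    ← p.coframe.sum_form_smul_dualFrame (Y x)]
  simp only [map_sum, map_smul, hE]
  exact Finset.sum_congr rfl fun c _ ↦ by rw [sub_eq_zero.1 (h c x)]

theorem extDeriv_shape (b : Fin 3) (X Y : VectorField M) (x : M) :
    extDeriv (p.shape b) X Y x = p.codazziDefect X Y (p.coframe.dualFrame b) x
      + p.Θ x (leviCivita p.coframe.metric (p.coframe.dualFrame b) x (X x)) (Y x)
      - p.Θ x (leviCivita p.coframe.metric (p.coframe.dualFrame b) x (Y x)) (X x) := by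
  rw [extDeriv, ← leviCivita_sub_leviCivita p.coframe.metric X.mdifferentiableAt
    Y.mdifferentiableAt]
  simp only [shape_apply, codazziDefect, covDeriv, map_sub,
    fun y ↦ p.symm y (p.coframe.dualFrame b y)]
  rw [p.symm x (Y x) (leviCivita p.coframe.metric _ x (X x)),
    p.symm x (X x) (leviCivita p.coframe.metric _ x (Y x))]
  ring

end General

section Exterior

variable {p : CauchyPair M} (he : ∀ a, p.ExteriorEq a) {x : M}

include he

theorem form_leviCivita (b c : Fin 3) (v : TangentSpace (𝓡 3) x) :
    p.coframe.form c x (leviCivita p.coframe.metric (p.coframe.dualFrame b) x v)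
      = δ c 0 * p.shape b x v - δ b 0 * p.shape c x v := by
  have shape_comm (a b : Fin 3) : p.shape a x (p.coframe.dualFrame b x)
      = p.shape b x (p.coframe.dualFrame a x) := p.symm x _ _
  have on_frame (a : Fin 3) : p.coframe.form c x
      (leviCivita p.coframe.metric (p.coframe.dualFrame b) x (p.coframe.dualFrame a x))
        = δ c 0 * p.shape b x (p.coframe.dualFrame a x)
          - δ b 0 * p.shape c x (p.coframe.dualFrame a x) := by
    have koszul := p.coframe.two_mul_form_leviCivita_dualFrame a b c x
    simp only [he _ _ _ _, wedge, Coframe.coe_dualField, Coframe.form_dualFrame] at koszul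
    rw [shape_comm b c, shape_comm a c, shape_comm a b] at koszul
    simp only [Matrix.one_apply, eq_comm (b := (0 : Fin 3))]
    linarith
  rw [← p.coframe.sum_form_smul_dualFrame v]
  simp only [map_sum, map_smul, on_frame, smul_eq_mul, mul_sub, Finset.sum_sub_distrib,
    Finset.mul_sum, mul_left_comm]

theorem apply_leviCivita (b : Fin 3) (v w : TangentSpace (𝓡 3) x) :
    p.Θ x (leviCivita p.coframe.metric (p.coframe.dualFrame b) x v) w
      = p.shape b x v * p.shape 0 x w - δ b 0 * ∑ d, p.shape d x v * p.shape d x w := by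
  simp only [apply_eq_sum, form_leviCivita he, sub_mul, Finset.sum_sub_distrib, Finset.mul_sum,
    mul_assoc]
  simp [Matrix.one_apply]

theorem inner_leviCivita (b c : Fin 3) (v w : TangentSpace (𝓡 3) x) :
    p.coframe.metric.inner x (leviCivita p.coframe.metric (p.coframe.dualFrame b) x v)
        (leviCivita p.coframe.metric (p.coframe.dualFrame c) x w)
      = p.shape b x v * p.shape c x w - δ c 0 * (p.shape b x v * p.shape 0 x w)
        - δ b 0 * (p.shape 0 x v * p.shape c x w)
        + δ b 0 * δ c 0 * ∑ d, p.shape d x v * p.shape d x w := by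
  simp only [Coframe.metric_apply, form_leviCivita he, Fin.sum_univ_three, Matrix.one_apply_eq,
    Matrix.one_apply_ne, Fin.reduceEq, ne_eq, not_false_eq_true]
  ring

theorem extDeriv_shape_eq_add_wedge (b : Fin 3) (X Y : VectorField M) (x : M) :
    extDeriv (p.shape b) X Y x = p.codazziDefect X Y (p.coframe.dualFrame b) x
      + wedge (p.shape b) (p.shape 0) X Y x := by
  simp only [extDeriv_shape, apply_leviCivita he, wedge,
    fun d ↦ mul_comm (p.shape d x (Y x)) (p.shape d x (X x))]
  ring

theorem closed_shape_zero_iff : p.shape 0 ∈ closedForms M ↔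
    ∀ (X Y : VectorField M) (x : M), p.codazziDefect X Y (p.coframe.dualFrame 0) x = 0 := by
  refine forall₃_congr fun X Y x ↦ ?_
  rw [extDeriv_shape_eq_add_wedge he, wedge]
  ring_nf

theorem mdifferentiableAt_leviCivita_dualFrame (b : Fin 3) (X : VectorField M) (x : M) :
    MDiffField (fun y ↦ leviCivita p.coframe.metric (p.coframe.dualFrame b) y (X y)) x := by
  refine p.coframe.mdifferentiableAt_of_form fun c ↦ ?_
  have shape_diff (a : Fin 3) := (p.shape a).mdifferentiableAt_apply (X.mdifferentiableAt (x := x))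
  simp only [form_leviCivita he]
  exact (mdifferentiableAt_const.mul (shape_diff b)).sub
    (mdifferentiableAt_const.mul (shape_diff c))

theorem mvfderiv_form_leviCivita (b c : Fin 3) (X : VectorField M) (v : TangentSpace (𝓡 3) x) :
    mvfderiv (𝓡 3) (fun y ↦ p.coframe.form c y
        (leviCivita p.coframe.metric (p.coframe.dualFrame b) y (X y))) x v
      = δ c 0 * mvfderiv (𝓡 3) (fun y ↦ p.shape b y (X y)) x v
        - δ b 0 * mvfderiv (𝓡 3) (fun y ↦ p.shape c y (X y)) x v := by
  have shape_diff (a : Fin 3) := (p.shape a).mdifferentiableAt_apply (X.mdifferentiableAt (x := x))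
  have scaled_diff (k : ℝ) (a : Fin 3) :
      MDifferentiableAt (𝓡 3) 𝓘(ℝ) (fun y ↦ k * p.shape a y (X y)) x :=
    mdifferentiableAt_const.mul (shape_diff a)
  simp only [form_leviCivita he]
  rw [mvfderiv_fun_sub (scaled_diff _ b) (scaled_diff _ c)]
  simp [mvfderiv_fun_mul mdifferentiableAt_const (shape_diff _), mvfderiv_const]

theorem form_curvature (b c : Fin 3) (X Y : VectorField M) (x : M) :
    p.coframe.form c x (curvature p.coframe.metric X Y (p.coframe.dualFrame b) x)
      = wedge (p.shape b) (p.shape c) X Y x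
        + δ c 0 * p.codazziDefect X Y (p.coframe.dualFrame b) x
        - δ b 0 * p.codazziDefect X Y (p.coframe.dualFrame c) x := by
  have gauss := inner_curvature p.coframe.metric
    (mdifferentiableAt_leviCivita_dualFrame he b Y x)
    (mdifferentiableAt_leviCivita_dualFrame he b X x) (p.coframe.mdifferentiableAt_dualFrame c x)
  simp only [Coframe.metric_dualFrame_right, mvfderiv_form_leviCivita he] at gauss
  simp only [form_leviCivita he, inner_leviCivita he] at gauss
  have hb := extDeriv_shape_eq_add_wedge he b X Y x
  have hc := extDeriv_shape_eq_add_wedge he c X Y x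
  simp only [extDeriv, wedge] at hb hc ⊢
  simp only [fun d ↦ mul_comm (p.shape d x (Y x)) (p.shape d x (X x))] at gauss
  linear_combination gauss + δ c 0 * hb - δ b 0 * hc

theorem scalarCurvature_eq (x : M) :
    scalarCurvature p.coframe.metric p.coframe.dualFrame x
      = p.normSq x - p.trace x ^ 2 - 2 * p.momentumDefect (p.coframe.dualFrame 0) x := by
  set E := p.coframe.dualFrame with hE
  have sectional (a b : Fin 3) : p.coframe.metric.inner x
      (curvature p.coframe.metric (E a) (E b) (E b) x) (E a x)
        = p.Θ x (E a x) (E b x) ^ 2 - p.Θ x (E a x) (E a x) * p.Θ x (E b x) (E b x)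
          - (δ a 0 * p.codazziDefect (E b) (E a) (E b) x
            + δ b 0 * p.codazziDefect (E a) (E b) (E a) x) := by
    have gauss := form_curvature he b a (p.coframe.dualField a) (p.coframe.dualField b) x
    simp only [Coframe.coe_dualField, wedge, shape_apply, ← hE] at gauss
    rw [p.coframe.metric_dualFrame_right, gauss, p.symm x (E b x) (E a x),
      p.codazziDefect_swap (E b) (E a) (E b)]
    ring
  simp only [scalarCurvature, sectional, momentumDefect_eq_sum_codazziDefect, normSq, trace,
    Finset.sum_sub_distrib, Finset.sum_add_distrib, sq (∑ _, _), Finset.sum_mul_sum, ← hE]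
  simp only [Matrix.one_apply, ite_mul, one_mul, zero_mul, Finset.sum_ite_irrel,
    Finset.sum_const_zero, Finset.sum_ite_eq', Finset.mem_univ, ↓reduceIte]
  ring

theorem hamiltonian_iff :
    p.Hamiltonian ↔ ∀ x, p.momentumDefect (p.coframe.dualFrame 0) x = 0 := by
  refine forall_congr' fun x ↦ ?_
  rw [scalarCurvature_eq he]
  constructor <;> intro h <;> linarith

theorem codazziDefect_dualFrame_eq_zero {b c d : Fin 3} (hb : b ≠ 0) (hc : c ≠ 0) (hd : d ≠ 0)
    (x : M) : p.codazziDefect (p.coframe.dualFrame b) (p.coframe.dualFrame c)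
      (p.coframe.dualFrame d) x = 0 := by
  have smooth (a : Fin 3) := (p.coframe.contMDiff_dualFrame a).of_le
    (show 2 ≤ ∞ from ENat.LEInfty.out)
  have bianchi := curvature_bianchi p.coframe.metric (x := x) (smooth b) (smooth c) (smooth 0)
    (mdifferentiableAt_leviCivita_dualFrame he b (p.coframe.dualField c) x)
    (mdifferentiableAt_leviCivita_dualFrame he c (p.coframe.dualField 0) x)
    (mdifferentiableAt_leviCivita_dualFrame he 0 (p.coframe.dualField b) x)
  have component := congrArg (p.coframe.form d x) bianchi
  have gauss (i j k : Fin 3) := form_curvature he k d (p.coframe.dualField i)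
    (p.coframe.dualField j) x
  simp only [Coframe.coe_dualField, wedge] at gauss
  simp only [map_add, map_zero, gauss] at component
  have shape_comm (a b : Fin 3) : p.shape a x (p.coframe.dualFrame b x)
      = p.shape b x (p.coframe.dualFrame a x) := p.symm x _ _
  simp only [Matrix.one_apply_ne, hb, hc, hd, Matrix.one_apply_eq, shape_comm c b, shape_comm b 0,
    shape_comm c 0, ne_eq, not_false_eq_true] at component
  -- The `Θ ∧ Θ` parts of the three curvatures cancel because `Θ` is symmetric.
  linear_combination -component

theorem momentumDefect_dualFrame_eq_zero (closed : p.shape 0 ∈ closedForms M) {c : Fin 3}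
    (hc : c ≠ 0) (x : M) : p.momentumDefect (p.coframe.dualFrame c) x = 0 := by
  rw [momentumDefect_eq_sum_codazziDefect]
  refine Finset.sum_eq_zero fun a _ ↦ ?_
  obtain rfl | ha := eq_or_ne a 0
  · exact (closed_shape_zero_iff he).1 closed (p.coframe.dualField 0) (p.coframe.dualField c) x
  · exact codazziDefect_dualFrame_eq_zero he ha hc ha x

theorem hamiltonian_iff_momentum (closed : p.shape 0 ∈ closedForms M) :
    p.Hamiltonian ↔ p.Momentum := by
  rw [hamiltonian_iff he, momentum_iff]
  refine ⟨fun h c x ↦ ?_, fun h ↦ h 0⟩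
  obtain rfl | hc := eq_or_ne c 0
  · exact h x
  · exact momentumDefect_dualFrame_eq_zero he closed hc x

end Exterior

end CauchyPair

end Frame

end CauchyGeometry

end

theorem mainTheorem9_general {M : Type*} [TopologicalSpace M] [ChartedSpace CauchyGeometry.E3 M]
    [IsManifold (𝓡 3) ∞ M] (p : CauchyGeometry.CauchyPair M) (he : ∀ a, p.ExteriorEq a) :
    (p.shape 0 ∈ CauchyGeometry.closedForms M → (p.Hamiltonian ↔ p.Momentum)) ∧
    (p.IsCodazzi → p.shape 0 ∈ CauchyGeometry.closedForms M ∧ p.Hamiltonian ∧ p.Momentum) := by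
  have equivalence := CauchyGeometry.CauchyPair.hamiltonian_iff_momentum he
  refine ⟨equivalence, fun codazzi ↦ ?_⟩
  have closed : p.shape 0 ∈ CauchyGeometry.closedForms M :=
    (CauchyGeometry.CauchyPair.closed_shape_zero_iff he).2 fun X Y x ↦
      codazzi.codazziDefect_eq_zero X Y (p.coframe.dualField 0) x
  exact ⟨closed, (equivalence closed).2 codazzi.momentum, codazzi.momentum⟩

theorem mainTheorem9 {M : Type*} [TopologicalSpace M] [T2Space M] [SecondCountableTopology M]
    [ChartedSpace CauchyGeometry.E3 M] [IsManifold (𝓡 3) ∞ M]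
    (p : CauchyGeometry.CauchyPair M) :
    (p.IsConstrainedRicciFlat ↔
      (p.ExteriorEq 0 ∧ p.ExteriorEq 1 ∧ p.ExteriorEq 2) ∧
        CauchyGeometry.VanishingClass (p.shape 0) ∧ p.Hamiltonian) ∧
    (p.IsParallel → p.IsCodazzi → p.IsConstrainedRicciFlat) := by
  refine ⟨⟨fun ⟨⟨he, class_zero⟩, hamiltonian, _⟩ ↦ ⟨⟨he 0, he 1, he 2⟩, class_zero, hamiltonian⟩,
    fun ⟨⟨hu, hl, hn⟩, class_zero, hamiltonian⟩ ↦ ?_⟩,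
    fun parallel codazzi ↦ ⟨parallel, ((mainTheorem9_general p parallel.1).2 codazzi).2⟩⟩
  have he : ∀ a, p.ExteriorEq a := Fin.forall_fin_succ.2 ⟨hu, Fin.forall_fin_two.2 ⟨hl, hn⟩⟩
  exact ⟨⟨he, class_zero⟩, hamiltonian, ((mainTheorem9_general p he).1 class_zero.1).1 hamiltonian⟩
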